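/- All graphs are finite, undirected and loopless; multiple edges are allowed (a multigraph). For a multigraph $G$ with vertex set $V$, let $e(S,T)$ be the number of edges with one end in $S$ and the other in $T$, for disjoint $S,T\subseteq V$, let $\kappa'(G)$ be the edge connectivity, that is, the minimum of $e(S,V\setminus S)$ over the non-empty proper subsets $S$ of $V$, let $\delta$ and $\Delta$ be the minimum and maximum degree (degrees count edges with multiplicity), and let the multiplicity $m$ of $G$ be the maximum number of edges between any pair of distinct vertices. Let $\lambda_3(G)$ be the third largest eigenvalue (counted with multiplicity) of the adjacency matrix of $G$, whose $(u,v)$ entry is the number of edges between $u$ and $v$. Let $\tau(G)$ be the maximum number of pairwise edge-disjoint spanning trees of $G$. Let $\mathcal G$ be the class of those $G$ for which there are two disjoint non-empty proper subsets $V_1,V_2$ of $V$ with $V\setminus(V_1\cup V_2)\neq\emptyset$ and $\kappa'(G)=e(V_1,V\setminus V_1)=e(V_2,V\setminus V_2)$. **Theorem 6.3.** Let $k\ge 2$ be an integer, let $G\in\mathcal G$ be a multigraph with multiplicity $m$ and minimum degree $\delta\ge 2k$, and set $l=\max\{\lceil(\delta+1)/m\rceil,2\}$. If $$\lambda_3(G)<2\delta-\Delta-\frac{2(3k-1)}{l},$$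 then $\tau(G)\ge k$. -/

import Mathlib

open scoped Graph

noncomputable section

namespace Graph

variable {α β : Type*}

/-- The number of edges joining `x` and `y`. -/
def edgeMult (G : Graph α β) (x y : α) : ℕ := {e | G.IsLink e x y}.ncard

/-- The multiplicity of a graph: the largest number of edges between a pair of vertices. -/
def multiplicity (G : Graph α β) : ℕ :=
  sSup {c | ∃ x ∈ V(G), ∃ y ∈ V(G), x ≠ y ∧ c = G.edgeMult x y}

/-- The degree of a vertex of a loopless graph: the number of edges incident with it. -/
def degree (G : Graph α β) (x : α) : ℕ := {e | G.Inc e x}.ncard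

/-- The minimum degree. -/
def minDegree (G : Graph α β) : ℕ := sInf (G.degree '' V(G))

/-- The maximum degree. -/
def maxDegree (G : Graph α β) : ℕ := sSup (G.degree '' V(G))

/-- `e(S, T)`: the number of edges with one end in `S` and the other end in `T`. -/
def edgesBetween (G : Graph α β) (S T : Set α) : ℕ :=
  {e | ∃ x ∈ S, ∃ y ∈ T, G.IsLink e x y}.ncard

/-- The edge connectivity: the smallest size of an edge cut `E(S, V \ S)`, where `S` ranges over the
nonempty proper subsets of the vertex set (and `0` for a graph with at most one vertex). -/
def edgeConnectivity (G : Graph α β) : ℕ :=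
  sInf {c | ∃ S : Set α, S.Nonempty ∧ S ⊂ V(G) ∧ c = G.edgesBetween S (V(G) \ S)}

/-- There are two disjoint nonempty proper subsets of the vertex set which do not cover it and
each of which determines an edge cut of minimum size. -/
def HasTwoMinCuts (G : Graph α β) : Prop :=
  ∃ V₁ V₂ : Set α, V₁.Nonempty ∧ V₂.Nonempty ∧ V₁ ⊂ V(G) ∧ V₂ ⊂ V(G) ∧ Disjoint V₁ V₂ ∧
    (V(G) \ (V₁ ∪ V₂)).Nonempty ∧
    G.edgeConnectivity = G.edgesBetween V₁ (V(G) \ V₁) ∧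
    G.edgeConnectivity = G.edgesBetween V₂ (V(G) \ V₂)

/-- The adjacency matrix: the `(x, y)` entry is the number of edges between `x` and `y`. -/
def adjacencyMatrix (G : Graph α β) : Matrix V(G) V(G) ℝ :=
  Matrix.of fun x y => (G.edgeMult x y : ℝ)

theorem edgeMult_comm (G : Graph α β) (x y : α) : G.edgeMult x y = G.edgeMult y x := by
  unfold edgeMult
  congr 1
  ext e
  exact G.isLink_comm

theorem adjacencyMatrix_isHermitian (G : Graph α β) : G.adjacencyMatrix.IsHermitian := by
  ext x y
  simp [adjacencyMatrix, G.edgeMult_comm y x]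

open Classical in
/-- The `i`-th largest eigenvalue `λᵢ` (`1 ≤ i ≤ |V|`, counted with multiplicity) of the adjacency
matrix of a graph with finitely many vertices; the value is `0` if `i` is out of range.
(`Matrix.IsHermitian.eigenvalues₀` lists the eigenvalues in non-increasing order, from index 0.) -/
def adjEigenvalue (G : Graph α β) [Fintype V(G)] (i : ℕ) : ℝ :=
  if h : 1 ≤ i ∧ i ≤ Fintype.card V(G) then
    G.adjacencyMatrix_isHermitian.eigenvalues₀ ⟨i - 1, by omega⟩
  else 0

/-- Any two vertices are joined by a walk, and there is at least one vertex. -/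
def IsConnected (G : Graph α β) : Prop :=
  V(G).Nonempty ∧ ∀ x ∈ V(G), ∀ y ∈ V(G), Relation.ReflTransGen G.Adj x y

/-- The graph has a cycle: distinct vertices `v 0, …, v n` and distinct edges `e 0, …, e n` such
that `e i` joins `v i` to `v (i + 1)`, indices being read modulo `n + 1`. (A loop is a cycle with
`n = 0`, and a pair of parallel edges is a cycle with `n = 1`.) -/
def HasCycle (G : Graph α β) : Prop :=
  ∃ (n : ℕ) (v : Fin (n + 1) → α) (e : Fin (n + 1) → β),
    Function.Injective v ∧ Function.Injective e ∧ ∀ i, G.IsLink (e i) (v i) (v (i + 1))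

/-- A tree is a connected graph without cycles. -/
def IsTree (G : Graph α β) : Prop := G.IsConnected ∧ ¬ G.HasCycle

/-- `τ(G)`: the maximum number of pairwise edge-disjoint spanning trees of `G`. It is an extended
natural number because a one-vertex graph has arbitrarily many of them; for a finite graph
with at least two vertices it is finite. -/
def spanningTreePacking (G : Graph α β) : ℕ∞ :=
  sSup {t | ∃ (n : ℕ) (T : Fin n → Graph α β), t = (n : ℕ∞) ∧
    (∀ i, (T i).IsSpanningSubgraph G ∧ (T i).IsTree) ∧
    ∀ i j, i ≠ j → Disjoint E(T i) E(T j)}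

end Graph

end

/-! Suppose that `k` disjoint spanning trees do not exist. By the Nash-Williams–Tutte theorem some
partition into `t` classes is crossed by fewer than `k (t - 1)` edges. This yields three disjoint
nonempty sets with at most `2k - 1` boundary edges each. If `κ' < k`, they are the two minimum cuts
and the remaining vertices, whose boundary has at most `2κ'` edges. If `κ' ≥ k`, every class has at
least `k` boundary edges while the boundaries sum to less than `2kt - 2k`, so at least three classes
fall below `2k`.

Since `2k ≤ δ`, counting degrees inside such a set shows that it has at least `l` vertices. Vectors
constant on each of the three sets and zero elsewhere form a 3-dimensional space on which the
Rayleigh quotient is at least `δ - 2(2k - 1)/l`, so `λ₃` is at least this. As `δ ≤ Δ` and `2k - 1 ≤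
3k - 1`, the hypothesis on `λ₃` is contradicted.

The tree packing theorem is itself proved by linear algebra: a packing criterion for families of
subspaces, resting on submodularity of dimension (`exists_disjoint_families_finrank`), is applied to
the lines spanned by the incidence vectors of the edges. -/

noncomputable section

/-! ### Packing disjoint spanning families of subspaces -/

namespace Submodule

variable {K W β ι : Type*} [Field K] [AddCommGroup W] [Module K W]

/-- The dimension of the sum of the subspaces `φ e` with `e ∈ X`. -/
def supRank (φ : β → Submodule K W) (X : Finset β) : ℕ := Module.finrank K ↥(X.sup φ)

variable [FiniteDimensional K W]

theorem supRank_mono (φ : β → Submodule K W) {X Y : Finset β} (h : X ⊆ Y) :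
    supRank φ X ≤ supRank φ Y :=
  Submodule.finrank_mono (Finset.sup_mono h)

/-- Submodularity of the dimension of the sum of a finite family of subspaces. -/
theorem finrank_sup_union_add_finrank_sup_inter_le [DecidableEq β] (φ : β → Submodule K W)
    (X Y : Finset β) :
    supRank φ (X ∪ Y) + supRank φ (X ∩ Y) ≤
      supRank φ X + supRank φ Y := by
  rw [supRank, Finset.sup_union, supRank, supRank, supRank,
    ← Submodule.finrank_sup_add_finrank_inf_eq (X.sup φ) (Y.sup φ)]
  refine Nat.add_le_add_left ?_ _
  exact Submodule.finrank_mono (le_inf (Finset.sup_mono Finset.inter_subset_left)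
    (Finset.sup_mono Finset.inter_subset_right))

/-- Uncrossing: the deficiency sum is supermodular in `X` and the number of remaining elements is
modular, so tightness of `X` and `Y`, with the inequality `h` at `X ∩ Y`, forces tightness of `X ∪
Y`. -/
theorem card_sdiff_le_of_tight_union [DecidableEq β] [Fintype ι] (φ : β → Submodule K W)
    (N : ℤ) (R : Finset β) (B : ι → Finset β)
    (h : ∀ X ⊆ R, ∑ i, (N - supRank φ (X ∪ B i)) ≤ ((R \ X).card : ℤ))
    {X Y : Finset β} (hXR : X ⊆ R)
    (hX : ((R \ X).card : ℤ) ≤ ∑ i, (N - supRank φ (X ∪ B i)))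
    (hY : ((R \ Y).card : ℤ) ≤ ∑ i, (N - supRank φ (Y ∪ B i))) :
    ((R \ (X ∪ Y)).card : ℤ) ≤ ∑ i, (N - supRank φ (X ∪ Y ∪ B i)) := by
  have h1 := h (X ∩ Y) (Finset.inter_subset_left.trans hXR)
  have h2 : (R \ (X ∪ Y)).card + (R \ (X ∩ Y)).card = (R \ X).card + (R \ Y).card := by
    rw [Finset.sdiff_union_distrib, Finset.sdiff_inter_distrib_right, add_comm]
    exact Finset.card_union_add_card_inter _ _
  have h3 : ∑ i, (N - supRank φ (X ∪ B i)) +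
      ∑ i, (N - supRank φ (Y ∪ B i)) ≤
      ∑ i, (N - supRank φ (X ∪ Y ∪ B i)) +
      ∑ i, (N - supRank φ (X ∩ Y ∪ B i)) := by
    rw [← Finset.sum_add_distrib, ← Finset.sum_add_distrib]
    refine Finset.sum_le_sum fun i _ => ?_
    have := finrank_sup_union_add_finrank_sup_inter_le φ (X ∪ B i) (Y ∪ B i)
    rw [← Finset.union_union_distrib_right, ← Finset.inter_union_distrib_right] at this
    zify at this
    linarith
  zify at h2
  linarith

/-- A family of subspaces indexed by `R` can be distributed over finitely many classes, each of
which is enlarged to span dimension `N`, as soon as every `X ⊆ R` leaves enough elements for what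
the classes lack after adding `X` to all of them. -/
theorem exists_disjoint_families_finrank [DecidableEq β] [Fintype ι] [Nonempty ι]
    (φ : β → Submodule K W) (N : ℕ) (hN : ∀ X : Finset β, supRank φ X ≤ N)
    (R : Finset β) (B : ι → Finset β) (hBR : ∀ i, Disjoint (B i) R)
    (hB : ∀ i j, i ≠ j → Disjoint (B i) (B j))
    (h : ∀ X ⊆ R, ∑ i, ((N : ℤ) - supRank φ (X ∪ B i)) ≤ ((R \ X).card : ℤ)) :
    ∃ C : ι → Finset β, (∀ i, C i ⊆ B i ∪ R) ∧ (∀ i j, i ≠ j → Disjoint (C i) (C j)) ∧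
      ∀ i, N ≤ supRank φ (C i) := by
  classical
  induction R using Finset.induction_on generalizing B with
  | empty =>
    refine ⟨B, fun i => by simp, hB, fun i => ?_⟩
    have h0 := h ∅ subset_rfl
    simp only [Finset.empty_union, Finset.sdiff_empty, Finset.card_empty, Nat.cast_zero] at h0
    have h1 : (N : ℤ) - supRank φ (B i) ≤
        ∑ i, ((N : ℤ) - supRank φ (B i)) :=
      Finset.single_le_sum (f := fun i => (N : ℤ) - supRank φ (B i))
        (fun j _ => by have := hN (B j); omega) (Finset.mem_univ i)
    omega
  | insert e R he ih =>
    by_cases hex : ∃ i, ∀ X ⊆ R, ∑ j, ((N : ℤ) - 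
        supRank φ (X ∪ Function.update B i (insert e (B i)) j)) ≤ ((R \ X).card : ℤ)
    · obtain ⟨i, hi⟩ := hex
      have heB : ∀ j, e ∉ B j := fun j hj =>
        Finset.disjoint_left.1 (hBR j) hj (Finset.mem_insert_self _ _)
      obtain ⟨C, hC1, hC2, hC3⟩ := ih (Function.update B i (insert e (B i)))
        (fun j => by
          have hj := (hBR j).mono_right (Finset.subset_insert e R)
          rcases eq_or_ne j i with rfl | hji
          · rw [Function.update_self, Finset.disjoint_insert_left]
            exact ⟨he, hj⟩
          · rwa [Function.update_of_ne hji])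
        (fun j j' hjj' => by
          rcases eq_or_ne j i with rfl | hji
          · rw [Function.update_self, Function.update_of_ne hjj'.symm, Finset.disjoint_insert_left]
            exact ⟨heB j', hB _ _ hjj'⟩
          · rw [Function.update_of_ne hji]
            rcases eq_or_ne j' i with rfl | hji'
            · rw [Function.update_self, Finset.disjoint_insert_right]
              exact ⟨heB j, hB _ _ hjj'⟩
            · rw [Function.update_of_ne hji']
              exact hB _ _ hjj') hi
      refine ⟨C, fun j => (hC1 j).trans ?_, hC2, hC3⟩
      rcases eq_or_ne j i with rfl | hji
      · rw [Function.update_self, Finset.insert_union, Finset.union_insert]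
      · rw [Function.update_of_ne hji]
        exact Finset.union_subset_union_right (Finset.subset_insert _ _)
    -- If `e` fits into no class, each class `i` has a violating set `X i`. Their union `U` is shown
    -- to be tight, with `φ e` already in the span of `U ∪ B j` for every `j`. Passing from `U` to
    -- `insert e U` then lowers the right side of `h` by one and leaves the left side unchanged.
    · exfalso
      push Not at hex
      choose X hXR hX using hex
      have hcard : ∀ Z ⊆ R, (insert e R \ Z).card = (R \ Z).card + 1 := fun Z hZ => by
        rw [Finset.insert_sdiff_of_notMem _ (fun hz => he (hZ hz)), Finset.card_insert_of_notMem]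
        exact fun hz => he (Finset.mem_sdiff.1 hz).1
      -- Adding `e` to class `i` cannot increase the deficiency sum. Before the addition the sum is
      -- at most `|R \ X i| + 1`, and after it still exceeds `|R \ X i|`. So `X i` is tight and no
      -- dimension was gained.
      have key : ∀ i, ((insert e R \ X i).card : ℤ) ≤
          ∑ j, ((N : ℤ) - supRank φ (X i ∪ B j)) ∧
          φ e ≤ (X i ∪ B i).sup φ := by
        intro i
        have hle : ∀ j, ((N : ℤ) - supRank φ (X i ∪ Function.update B i (insert e (B i)) j)) ≤
            (N : ℤ) - supRank φ (X i ∪ B j) := by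
          intro j
          have : supRank φ (X i ∪ B j) ≤
              supRank φ (X i ∪ Function.update B i (insert e (B i)) j) := by
            refine supRank_mono φ (Finset.union_subset_union_right ?_)
            rcases eq_or_ne j i with rfl | hji
            · rw [Function.update_self]
              exact Finset.subset_insert _ _
            · rw [Function.update_of_ne hji]
          omega
        have h1 := Finset.sum_le_sum fun j (_ : j ∈ Finset.univ) => hle j
        have h2 := h (X i) ((hXR i).trans (Finset.subset_insert _ _))
        have h3 := hX i
        have h4 := hcard (X i) (hXR i)
        refine ⟨by omega, ?_⟩
        by_contra hcon
        have hlt := Finset.sum_lt_sum (fun j (_ : j ∈ Finset.univ) => hle j)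
          ⟨i, Finset.mem_univ i, by
            have : supRank φ (X i ∪ B i) <
                supRank φ (X i ∪ Function.update B i (insert e (B i)) i) := by
              rw [supRank, supRank, Function.update_self, Finset.union_insert, Finset.sup_insert]
              exact Submodule.finrank_lt_finrank_of_lt (right_lt_sup.2 hcon)
            omega⟩
        omega
      have hU : ∀ s : Finset ι, s.Nonempty → ((insert e R \ s.biUnion X).card : ℤ) ≤
          ∑ j, ((N : ℤ) - supRank φ (s.biUnion X ∪ B j)) := by
        intro s hs
        induction hs using Finset.Nonempty.cons_induction with
        | singleton i => simpa using (key i).1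
        | cons i s hi hs ihs =>
          rw [Finset.cons_eq_insert, Finset.biUnion_insert]
          exact card_sdiff_le_of_tight_union φ N _ B h
            ((hXR i).trans (Finset.subset_insert _ _)) (key i).1 ihs
      have hU1 := hU Finset.univ Finset.univ_nonempty
      generalize hUdef : Finset.univ.biUnion X = U at hU1
      have hUR : U ⊆ R := hUdef ▸ Finset.biUnion_subset.2 fun i _ => hXR i
      have h2 := h (insert e U) (Finset.insert_subset_insert _ hUR)
      have h3 : ∀ j, supRank φ (insert e U ∪ B j) = supRank φ (U ∪ B j) := by
        intro j
        rw [supRank, supRank, Finset.insert_union, Finset.sup_insert, sup_eq_right.2]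
        refine (key j).2.trans (Finset.sup_mono (Finset.union_subset_union_left ?_))
        exact hUdef ▸ Finset.subset_biUnion_of_mem X (Finset.mem_univ j)
      simp only [h3] at h2
      have h4 : insert e R \ insert e U = R \ U := by
        ext x
        simp only [Finset.mem_sdiff, Finset.mem_insert]
        constructor
        · tauto
        · rintro ⟨hx, hxU⟩
          refine ⟨Or.inr hx, ?_⟩
          rintro (rfl | h)
          · exact he hx
          · exact hxU h
      rw [h4] at h2
      clear hX
      have h5 := hcard U hUR
      omega

end Submodule

end

/-! ### Incidence vectors and the Nash-Williams–Tutte theorem -/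

noncomputable section

namespace Graph

variable {α β : Type*}

/-- The span of the differences of the ends of an edge, in the free space on the vertices. -/
def incidenceSpan (G : Graph α β) (e : β) : Submodule ℚ (V(G) → ℚ) :=
  open Classical in
  Submodule.span ℚ {w | ∃ x y : V(G), G.IsLink e x y ∧ w = Pi.single x 1 - Pi.single y 1}

open Classical in
theorem single_sub_single_mem_sup_incidenceSpan (G : Graph α β) {X : Finset β} {e : β}
    (he : e ∈ X) {x y : V(G)} (h : G.IsLink e x y) :
    (Pi.single x 1 - Pi.single y 1 : V(G) → ℚ) ∈ X.sup G.incidenceSpan :=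
  (Finset.le_sup (f := G.incidenceSpan) he) (Submodule.subset_span ⟨x, y, h, rfl⟩)

open Classical in
theorem sup_incidenceSpan_le_iff (G : Graph α β) {X : Finset β} {S : Submodule ℚ (V(G) → ℚ)} :
    X.sup G.incidenceSpan ≤ S ↔
      ∀ e ∈ X, ∀ x y : V(G), G.IsLink e x y → Pi.single x 1 - Pi.single y 1 ∈ S := by
  simp only [Finset.sup_le_iff, incidenceSpan, Submodule.span_le]
  refine forall₂_congr fun e _ => ⟨fun h x y hxy => h ⟨x, y, hxy, rfl⟩, ?_⟩
  rintro h _ ⟨x, y, hxy, rfl⟩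
  exact h x y hxy

/-- The sum of the coordinates in a finite set of vertices. -/
def coordSum (G : Graph α β) (C : Finset V(G)) : (V(G) → ℚ) →ₗ[ℚ] ℚ :=
  ∑ x ∈ C, LinearMap.proj x

open Classical in
theorem coordSum_single (G : Graph α β) (C : Finset V(G)) (x : V(G)) :
    G.coordSum C (Pi.single x 1) = if x ∈ C then 1 else 0 := by
  simp [coordSum, Pi.single_apply]

/-- A connected graph with a finite edge set `X` has a spanning tree. -/
theorem exists_isTree_restrict (G : Graph α β) (X : Finset β)
    (hX : (G.restrict (X : Set β)).IsConnected) :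
    ∃ T ⊆ X, (G.restrict (T : Set β)).IsTree := by
  classical
  induction X using Finset.strongInduction with
  | H X ih =>
    by_cases hcyc : (G.restrict (X : Set β)).HasCycle
    · obtain ⟨n, v, e, hv, he, hlink⟩ := hcyc
      have hmem : e (Fin.last n) ∈ X := (hlink (Fin.last n)).1
      have hsub : X.erase (e (Fin.last n)) ⊂ X := Finset.erase_ssubset hmem
      -- Deleting one edge of a cycle keeps the graph connected: the rest of the cycle joins its
      -- ends.
      suffices hconn : (G.restrict (X \ {e (Fin.last n)} : Set β)).IsConnected by
        obtain ⟨T, hT, hT'⟩ := ih _ hsub (by simpa using hconn)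
        exact ⟨T, hT.trans hsub.subset, hT'⟩
      refine ⟨hX.1, fun x hx y hy => ?_⟩
      have hpath : ∀ i : ℕ, ∀ hi : i < n + 1, Relation.ReflTransGen
          (G.restrict (X \ {e (Fin.last n)} : Set β)).Adj (v 0) (v ⟨i, hi⟩) := by
        intro i
        induction i with
        | zero => intro _; exact .refl
        | succ i ihi =>
          intro hi
          refine (ihi (by omega)).tail ⟨e ⟨i, by omega⟩, ?_⟩
          have hl := hlink ⟨i, by omega⟩
          have hne : e ⟨i, by omega⟩ ≠ e (Fin.last n) := fun h => by
            have := congrArg Fin.val (he h)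
            simp at this
            omega
          have hs : (⟨i, by omega⟩ : Fin (n + 1)) + 1 = ⟨i + 1, hi⟩ := by
            ext
            rw [Fin.val_add_one_of_lt (by rw [Fin.lt_def]; simpa using hi)]
          rw [hs] at hl
          exact ⟨by simpa using ⟨hl.1, hne⟩, hl.2⟩
      have hlast := hlink (Fin.last n)
      rw [Fin.last_add_one] at hlast
      have h0 := hX.2 x hx y hy
      clear hx hy
      induction h0 with
      | refl => exact .refl
      | tail _ hbc ihb =>
        refine ihb.trans ?_
        obtain ⟨f, hf⟩ := hbc
        by_cases hfe : f = e (Fin.last n)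
        · subst hfe
          rcases hf.eq_and_eq_or_eq_and_eq hlast with ⟨rfl, rfl⟩ | ⟨rfl, rfl⟩
          · exact Relation.ReflTransGen.stdSymm.symm _ _ (hpath n (by omega))
          · exact hpath n (by omega)
        · exact .single ⟨f, by simpa using ⟨hf.1, hfe⟩, hf.2⟩
    · exact ⟨X, subset_rfl, hX, hcyc⟩

/-- The number of edges joining different classes of a partition of the vertices. -/
def crossing (G : Graph α β) (s : Setoid V(G)) : ℕ :=
  {e | ∃ x y : V(G), G.IsLink e x y ∧ ¬ s x y}.ncard

variable (G : Graph α β) [Fintype V(G)]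

theorem sup_incidenceSpan_le_ker_coordSum_univ (X : Finset β) :
    X.sup G.incidenceSpan ≤ LinearMap.ker (G.coordSum Finset.univ) := by
  classical
  rw [sup_incidenceSpan_le_iff]
  intro e _ x y _
  simp [coordSum_single]

theorem ker_coordSum_univ_lt_top (h : V(G).Nonempty) :
    LinearMap.ker (G.coordSum Finset.univ) < ⊤ := by
  classical
  obtain ⟨x, hx⟩ := h
  refine lt_top_iff_ne_top.2 fun htop => ?_
  have : (Pi.single (⟨x, hx⟩ : V(G)) 1 : V(G) → ℚ) ∈
      LinearMap.ker (G.coordSum Finset.univ) := htop ▸ Submodule.mem_top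
  simp [coordSum_single] at this

theorem supRank_incidenceSpan_add_one_le (h : V(G).Nonempty) (X : Finset β) :
    Submodule.supRank G.incidenceSpan X + 1 ≤ Fintype.card V(G) := by
  have h1 := Submodule.finrank_mono (G.sup_incidenceSpan_le_ker_coordSum_univ X)
  have h2 := Submodule.finrank_lt_finrank_of_lt (G.ker_coordSum_univ_lt_top h)
  rw [finrank_top, Module.finrank_fintype_fun_eq_card] at h2
  unfold Submodule.supRank
  omega

/-- A set of edges whose incidence vectors have full rank connects the graph. -/
theorem isConnected_restrict_of_card_le_supRank (h : V(G).Nonempty) (X : Finset β)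
    (hX : Fintype.card V(G) ≤ Submodule.supRank G.incidenceSpan X + 1) :
    (G.restrict (X : Set β)).IsConnected := by
  classical
  refine ⟨h, fun x hx y hy => ?_⟩
  by_contra hxy
  change x ∈ V(G) at hx; change y ∈ V(G) at hy
  set C : Finset V(G) := Finset.univ.filter fun z =>
    Relation.ReflTransGen (G.restrict (X : Set β)).Adj x z with hC
  -- If `y` is not reachable from `x`, no edge of `X` leaves the component `C` of `x`. The span then
  -- satisfies two independent linear equations, so its rank is at most `|V| - 2`.
  have h1 : X.sup G.incidenceSpan ≤
      LinearMap.ker (G.coordSum Finset.univ) ⊓ LinearMap.ker (G.coordSum C) := by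
    refine le_inf (G.sup_incidenceSpan_le_ker_coordSum_univ X) ?_
    rw [sup_incidenceSpan_le_iff]
    intro e he u v huv
    have huv' : (G.restrict (X : Set β)).Adj u v := ⟨e, he, huv⟩
    have : u ∈ C ↔ v ∈ C := by
      simp only [hC, Finset.mem_filter, Finset.mem_univ, true_and]
      exact ⟨fun h => h.tail huv', fun h => h.tail huv'.symm⟩
    simp [coordSum_single, this]
  have h2 : LinearMap.ker (G.coordSum Finset.univ) ⊓ LinearMap.ker (G.coordSum C) <
      LinearMap.ker (G.coordSum Finset.univ) := by
    refine inf_lt_left.2 fun hle => ?_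
    have hmem : (Pi.single (⟨x, hx⟩ : V(G)) 1 - Pi.single (⟨y, hy⟩ : V(G)) 1 : V(G) → ℚ) ∈
        LinearMap.ker (G.coordSum Finset.univ) := by simp [coordSum_single]
    have hxC : (⟨x, hx⟩ : V(G)) ∈ C := by simp [hC, Relation.ReflTransGen.refl]
    have hyC : (⟨y, hy⟩ : V(G)) ∉ C := by simpa [hC] using hxy
    have := hle hmem
    simp [coordSum_single, hxC, hyC] at this
  have h3 := Submodule.finrank_mono h1
  have h4 := Submodule.finrank_lt_finrank_of_lt h2
  have h5 := Submodule.finrank_lt_finrank_of_lt (G.ker_coordSum_univ_lt_top h)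
  rw [finrank_top, Module.finrank_fintype_fun_eq_card] at h5
  unfold Submodule.supRank at hX
  omega

open Classical in
/-- The partition of the vertices into classes connected by the edges in `X`, expressed through
the span of the incidence vectors. -/
def spanSetoid (X : Finset β) : Setoid V(G) where
  r x y := (Pi.single x 1 - Pi.single y 1 : V(G) → ℚ) ∈ X.sup G.incidenceSpan
  iseqv :=
    { refl := fun x => by simp
      symm := fun {x y} h => by simpa using Submodule.neg_mem _ h
      trans := fun {x y z} h h' => by simpa using Submodule.add_mem _ h h' }

/-- The unit vectors of one representative per class, together with the span of the incidence
vectors, generate the whole space. -/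
theorem card_le_card_quotient_add_supRank (X : Finset β) :
    Fintype.card V(G) ≤
      Nat.card (Quotient (G.spanSetoid X)) + Submodule.supRank G.incidenceSpan X := by
  classical
  set Q := Quotient (G.spanSetoid X)
  let f : Q → (V(G) → ℚ) := fun q => Pi.single q.out 1
  have htop : Submodule.span ℚ (Set.range f) ⊔ X.sup G.incidenceSpan = ⊤ := by
    rw [eq_top_iff, ← (Pi.basisFun ℚ V(G)).span_eq, Submodule.span_le]
    rintro _ ⟨x, rfl⟩
    rw [Pi.basisFun_apply]
    have h1 : (Pi.single x 1 - Pi.single (Quotient.mk (G.spanSetoid X) x).out 1 : V(G) → ℚ) ∈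
        X.sup G.incidenceSpan := (G.spanSetoid X).symm (Quotient.mk_out x)
    have h2 : (Pi.single (Quotient.mk (G.spanSetoid X) x).out 1 : V(G) → ℚ) ∈
        Submodule.span ℚ (Set.range f) := Submodule.subset_span ⟨_, rfl⟩
    have := Submodule.add_mem_sup h2 h1
    simpa using this
  have h1 := Submodule.finrank_add_le_finrank_add_finrank (Submodule.span ℚ (Set.range f))
    (X.sup G.incidenceSpan)
  rw [htop, finrank_top, Module.finrank_fintype_fun_eq_card] at h1
  have h2 := finrank_range_le_card (R := ℚ) f
  rw [Set.finrank] at h2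
  rw [Nat.card_eq_fintype_card]
  unfold Submodule.supRank
  omega

/-- The tree packing theorem of Nash-Williams and Tutte: if every partition of the vertices into
`t` classes is crossed by at least `k (t - 1)` edges, there are `k` disjoint spanning trees. -/
theorem le_spanningTreePacking_of_crossing (hE : E(G).Finite) (hV : V(G).Nonempty) (k : ℕ)
    (h : ∀ s : Setoid V(G), k * Nat.card (Quotient s) ≤ G.crossing s + k) :
    (k : ℕ∞) ≤ G.spanningTreePacking := by
  classical
  rcases Nat.eq_zero_or_pos k with rfl | hk
  · simp
  have : Nonempty (Fin k) := ⟨⟨0, hk⟩⟩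
  have hrank := G.supRank_incidenceSpan_add_one_le hV
  obtain ⟨C, -, hC2, hC3⟩ := Submodule.exists_disjoint_families_finrank (ι := Fin k)
    G.incidenceSpan (Fintype.card V(G) - 1) (fun X => by have := hrank X; omega) hE.toFinset
    (fun _ => ∅) (by simp) (by simp) (fun X _ => by
      have h1 := h (G.spanSetoid X)
      have h2 := G.card_le_card_quotient_add_supRank X
      -- An edge of `X` has both ends in one class of `spanSetoid X`, so crossing edges lie outside
      -- `X`.
      have h3 : G.crossing (G.spanSetoid X) ≤ (hE.toFinset \ X).card := by
        rw [crossing, ← Set.ncard_coe_finset]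
        refine Set.ncard_le_ncard ?_ (Finset.finite_toSet _)
        rintro e ⟨x, y, hxy, hs⟩
        simp only [Finset.coe_sdiff, Set.Finite.coe_toFinset, Set.mem_sdiff, Finset.mem_coe]
        exact ⟨hxy.edge_mem, fun he =>
          hs (G.single_sub_single_mem_sup_incidenceSpan he hxy)⟩
      have h4 := hrank X
      simp only [Finset.union_empty, Finset.sum_const, Finset.card_univ, Fintype.card_fin,
        nsmul_eq_mul]
      have h5 : (k : ℤ) * (((Fintype.card V(G) - 1 : ℕ) : ℤ) -
          Submodule.supRank G.incidenceSpan X) ≤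
          k * ((Nat.card (Quotient (G.spanSetoid X)) : ℤ) - 1) :=
        mul_le_mul_of_nonneg_left (by omega) (by omega)
      zify at h1 h3
      linarith)
  choose T hT hT' using fun i => G.exists_isTree_restrict (C i)
    (G.isConnected_restrict_of_card_le_supRank hV (C i) (by have := hC3 i; omega))
  refine le_sSup ⟨k, fun i => G.restrict (T i), rfl, fun i => ⟨⟨restrict_le, rfl⟩, hT' i⟩, ?_⟩
  intro i j hij
  have := Finset.disjoint_coe.2 ((hC2 i j hij).mono (hT i) (hT j))
  exact this.mono Set.inter_subset_right Set.inter_subset_right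

end Graph

end

/-! ### Three disjoint sets with small boundary -/

noncomputable section

namespace Graph

variable {α β : Type*}

/-- An edge leaving the complement of `V₁ ∪ V₂` enters `V₁` or `V₂`, and so is counted in one of
their boundaries. -/
theorem edgesBetween_compl_union_le (G : Graph α β) (hE : E(G).Finite) (V₁ V₂ : Set α) :
    G.edgesBetween (V(G) \ (V₁ ∪ V₂)) (V(G) \ (V(G) \ (V₁ ∪ V₂))) ≤
      G.edgesBetween V₁ (V(G) \ V₁) + G.edgesBetween V₂ (V(G) \ V₂) := by
  refine le_trans (Set.ncard_le_ncard ?_ (hE.subset ?_)) (Set.ncard_union_le _ _)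
  · rintro e ⟨x, ⟨hx, hx'⟩, y, ⟨hy, hy'⟩, hxy⟩
    simp only [Set.mem_union, not_or] at hx'
    have : y ∈ V₁ ∪ V₂ := by
      by_contra h
      exact hy' ⟨hy, h⟩
    rcases this with h | h
    · exact Or.inl ⟨y, h, x, ⟨hx, hx'.1⟩, hxy.symm⟩
    · exact Or.inr ⟨y, h, x, ⟨hx, hx'.2⟩, hxy.symm⟩
  · rintro e (⟨x, -, y, -, hxy⟩ | ⟨x, -, y, -, hxy⟩) <;> exact hxy.edge_mem

/-- The class of a partition of the vertices, as a set. -/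
def part (G : Graph α β) (s : Setoid V(G)) (q : Quotient s) : Set α :=
  {x | ∃ h : x ∈ V(G), Quotient.mk s ⟨x, h⟩ = q}

/-- Double counting: a crossing edge lies in the boundary of at most the two classes containing its
ends. -/
theorem sum_edgesBetween_part_le (G : Graph α β) [Fintype V(G)] (hE : E(G).Finite)
    (s : Setoid V(G)) [Fintype (Quotient s)] :
    ∑ q, G.edgesBetween (G.part s q) (V(G) \ G.part s q) ≤ 2 * G.crossing s := by
  classical
  have hfin : {e | ∃ x y : V(G), G.IsLink e x y ∧ ¬ s x y}.Finite :=
    hE.subset fun e ⟨x, y, hxy, _⟩ => hxy.edge_mem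
  have h1 : ∀ q, G.edgesBetween (G.part s q) (V(G) \ G.part s q) =
      (Finset.bipartiteAbove
        (fun q e => ∃ x ∈ G.part s q, ∃ y ∈ V(G) \ G.part s q, G.IsLink e x y)
        hfin.toFinset q).card := by
    intro q
    rw [edgesBetween, ← Set.ncard_coe_finset]
    congr 1
    ext e
    simp only [Set.mem_ofPred_eq, Finset.bipartiteAbove, Finset.coe_filter,
      Set.Finite.mem_toFinset]
    refine ⟨fun h => ⟨?_, h⟩, fun h => h.2⟩
    obtain ⟨x, ⟨hx, hxq⟩, y, ⟨hy, hyq⟩, hxy⟩ := h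
    refine ⟨⟨x, hx⟩, ⟨y, hy⟩, hxy, fun hs => hyq ⟨hy, ?_⟩⟩
    rw [← hxq]
    exact (Quotient.sound hs).symm
  simp only [h1]
  rw [Finset.sum_card_bipartiteAbove_eq_sum_card_bipartiteBelow, crossing,
    Set.ncard_eq_toFinset_card _ hfin, mul_comm]
  refine Finset.sum_le_card_nsmul _ _ _ fun e he => ?_
  obtain ⟨u, v, huv, -⟩ := hfin.mem_toFinset.1 he
  refine (Finset.card_le_card (t := {Quotient.mk s u, Quotient.mk s v}) ?_).trans
    Finset.card_le_two
  intro q hq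
  simp only [Finset.bipartiteBelow, Finset.mem_filter, Finset.mem_univ, true_and] at hq
  obtain ⟨x, ⟨hx, rfl⟩, y, -, hxy⟩ := hq
  simp only [Finset.mem_insert, Finset.mem_singleton]
  rcases hxy.left_eq_or_eq huv with rfl | rfl
  · exact Or.inl rfl
  · exact Or.inr rfl

/-- If a partition of the vertices of a graph with two minimum cuts is crossed by too few edges for the
existence of `k` disjoint spanning trees, three disjoint sets have fewer than `2 k` boundary
edges. -/
theorem HasTwoMinCuts.exists_three_cuts {G : Graph α β} [Fintype V(G)] (hE : E(G).Finite)
    (hG : G.HasTwoMinCuts) {k : ℕ} {s : Setoid V(G)}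
    (hs : G.crossing s + k < k * Nat.card (Quotient s)) :
    ∃ A : Fin 3 → Set α, (∀ i, A i ⊆ V(G)) ∧ (∀ i, (A i).Nonempty) ∧
      (∀ i j, i ≠ j → Disjoint (A i) (A j)) ∧
      ∀ i, G.edgesBetween (A i) (V(G) \ A i) < 2 * k := by
  classical
  rcases lt_or_ge G.edgeConnectivity k with hk | hk
  · obtain ⟨V₁, V₂, hV₁, hV₂, hs₁, hs₂, hd, h₃, h₁, h₂⟩ := hG
    have h := G.edgesBetween_compl_union_le hE V₁ V₂
    have hd₁ : Disjoint V₁ (V(G) \ (V₁ ∪ V₂)) :=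
      Set.disjoint_sdiff_right.mono_left Set.subset_union_left
    have hd₂ : Disjoint V₂ (V(G) \ (V₁ ∪ V₂)) :=
      Set.disjoint_sdiff_right.mono_left Set.subset_union_right
    refine ⟨![V₁, V₂, V(G) \ (V₁ ∪ V₂)], ?_, ?_, ?_, ?_⟩
    · simp [Fin.forall_fin_succ, hs₁.subset, hs₂.subset]
    · simp only [Fin.forall_fin_succ]
      simpa using ⟨hV₁, hV₂, h₃⟩
    · simp [Fin.forall_fin_succ, hd, hd.symm, hd₁, hd₁.symm, hd₂, hd₂.symm,
        -Set.disjoint_union_left, -Set.disjoint_union_right]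
    · simp only [Fin.forall_fin_succ]
      simp only [Matrix.cons_val_zero, Matrix.cons_val_succ, Matrix.cons_val_fin_one,
        IsEmpty.forall_iff, and_true]
      exact ⟨by omega, by omega, by omega⟩
  · have hne : ∀ q, (G.part s q).Nonempty := fun q => by
      obtain ⟨⟨x, hx⟩, rfl⟩ := Quotient.exists_rep q
      exact ⟨x, hx, rfl⟩
    have hdisj : ∀ q q', q ≠ q' → Disjoint (G.part s q) (G.part s q') := fun q q' hqq' =>
      Set.disjoint_left.2 fun x ⟨_, h⟩ ⟨_, h'⟩ => hqq' (h.symm.trans h')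
    have hsub : ∀ q, G.part s q ⊆ V(G) := fun q x hx => hx.1
    rw [Nat.card_eq_fintype_card] at hs
    have hnt : 1 < Fintype.card (Quotient s) := by
      by_contra! h
      have := Nat.mul_le_mul_left k h
      omega
    have hcut : ∀ q, k ≤ G.edgesBetween (G.part s q) (V(G) \ G.part s q) := by
      intro q
      obtain ⟨q', hq'⟩ := Fintype.exists_ne_of_one_lt_card hnt q
      refine hk.trans (Nat.sInf_le ⟨_, hne q, ⟨hsub q, fun hle => ?_⟩, rfl⟩)
      obtain ⟨x, hx⟩ := hne q'
      exact Set.disjoint_left.1 (hdisj q' q hq') hx (hle (hsub q' hx))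
    set F := Finset.univ.filter fun q =>
      G.edgesBetween (G.part s q) (V(G) \ G.part s q) < 2 * k with hF
    -- A class in `F` misses the value `2k` by at most `k`. With at most two such classes the
    -- boundaries would sum to at least `2kt - 2k`, against the bound by twice the crossing number.
    have hF3 : 3 ≤ F.card := by
      by_contra! h
      have h1 := G.sum_edgesBetween_part_le hE s
      have h2 : ∑ _q : Quotient s, 2 * k ≤ ∑ q, (G.edgesBetween (G.part s q) (V(G) \ G.part s q) +
          if G.edgesBetween (G.part s q) (V(G) \ G.part s q) < 2 * k then k else 0) := by
        refine Finset.sum_le_sum fun q _ => ?_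
        have := hcut q
        split_ifs <;> omega
      rw [Finset.sum_add_distrib, ← Finset.sum_filter, ← hF, Finset.sum_const, Finset.sum_const,
        Finset.card_univ, smul_eq_mul, smul_eq_mul] at h2
      have h3 : F.card * k ≤ 2 * k := Nat.mul_le_mul_right k (by omega)
      nlinarith
    obtain ⟨F', hF', hcard⟩ := Finset.exists_subset_card_eq hF3
    let f := (F'.equivFinOfCardEq hcard).symm
    refine ⟨fun i => G.part s (f i), fun i => hsub _, fun i => hne _, fun i j hij => ?_,
      fun i => ?_⟩
    · exact hdisj _ _ fun h => hij (f.injective (Subtype.ext h))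
    · exact (Finset.mem_filter.1 (hF' (f i).2)).2

/-! ### Degrees, multiplicities and the size of a set with small boundary -/

theorem edgeMult_le_ncard_edgeSet (G : Graph α β) (hE : E(G).Finite) (x y : α) :
    G.edgeMult x y ≤ E(G).ncard :=
  Set.ncard_le_ncard (fun _ he => IsLink.edge_mem he) hE

theorem edgeMult_le_multiplicity (G : Graph α β) (hE : E(G).Finite) {x y : α} (hx : x ∈ V(G))
    (hy : y ∈ V(G)) (hxy : x ≠ y) : G.edgeMult x y ≤ G.multiplicity := by
  refine le_csSup ⟨E(G).ncard, ?_⟩ ⟨x, hx, y, hy, hxy, rfl⟩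
  rintro _ ⟨x, -, y, -, -, rfl⟩
  exact G.edgeMult_le_ncard_edgeSet hE x y

theorem minDegree_le_degree (G : Graph α β) {x : α} (hx : x ∈ V(G)) :
    G.minDegree ≤ G.degree x :=
  Nat.sInf_le (Set.mem_image_of_mem _ hx)

theorem minDegree_le_maxDegree (G : Graph α β) (hE : E(G).Finite) (hV : V(G).Nonempty) :
    G.minDegree ≤ G.maxDegree := by
  obtain ⟨x, hx⟩ := hV
  refine (G.minDegree_le_degree hx).trans (le_csSup ⟨E(G).ncard, ?_⟩ ⟨x, hx, rfl⟩)
  rintro _ ⟨x, -, rfl⟩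
  exact Set.ncard_le_ncard (fun _ he => Inc.edge_mem he) hE

theorem edgeMult_self (G : Graph α β) [G.Loopless] (x : α) : G.edgeMult x x = 0 := by
  rw [edgeMult, Set.eq_empty_of_forall_notMem (s := {e | G.IsLink e x x})
    (fun e he => G.not_isLoopAt e x he), Set.ncard_empty]

variable (G : Graph α β) [Fintype V(G)]

theorem minDegree_le_sum_edgeMult (hE : E(G).Finite) (x : V(G)) :
    G.minDegree ≤ ∑ y : V(G), G.edgeMult x y := by
  classical
  refine (G.minDegree_le_degree x.2).trans ?_
  have hfin : ∀ y : V(G), {e | G.IsLink e x y}.Finite := fun y =>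
    hE.subset fun e he => IsLink.edge_mem he
  have h : {e | G.Inc e x} ⊆
      ((Finset.univ.biUnion fun y : V(G) => (hfin y).toFinset : Finset β) : Set β) := by
    rintro e ⟨y, hxy⟩
    simp only [Finset.coe_biUnion, Set.mem_iUnion]
    exact ⟨⟨y, hxy.right_mem⟩, by simp, by simpa using hxy⟩
  refine (Set.ncard_le_ncard h (Finset.finite_toSet _)).trans ?_
  rw [Set.ncard_coe_finset]
  refine Finset.card_biUnion_le.trans (Finset.sum_le_sum fun y _ => ?_)
  rw [edgeMult, Set.ncard_eq_toFinset_card _ (hfin y)]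

open Classical in
/-- The vertices in a set, as a finset. -/
def vertexFinset (S : Set α) : Finset V(G) := Finset.univ.filter fun x => (x : α) ∈ S

theorem mem_vertexFinset {S : Set α} {x : V(G)} : x ∈ G.vertexFinset S ↔ (x : α) ∈ S := by
  simp [vertexFinset]

open Classical in
theorem sum_edgeMult_le_edgesBetween (hE : E(G).Finite) (S : Set α) :
    ∑ x ∈ G.vertexFinset S, ∑ y ∈ (G.vertexFinset S)ᶜ, G.edgeMult x y ≤
      G.edgesBetween S (V(G) \ S) := by
  have hfin : ∀ x y : V(G), {e | G.IsLink e x y}.Finite := fun x y =>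
    hE.subset fun e he => IsLink.edge_mem he
  have h1 : ∀ x y : V(G), G.edgeMult x y = (hfin x y).toFinset.card := fun x y =>
    Set.ncard_eq_toFinset_card _ (hfin x y)
  simp only [h1]
  rw [← Finset.sum_product', ← Finset.card_biUnion, ← Set.ncard_coe_finset, edgesBetween]
  · refine Set.ncard_le_ncard ?_ (hE.subset ?_)
    · intro e he
      simp only [Finset.coe_biUnion, Set.mem_iUnion, Finset.mem_coe, Finset.mem_product,
        Finset.mem_compl, mem_vertexFinset, Set.Finite.mem_toFinset] at he
      obtain ⟨⟨x, y⟩, ⟨hx, hy⟩, hxy⟩ := he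
      exact ⟨x, hx, y, ⟨y.2, hy⟩, hxy⟩
    · rintro e ⟨x, -, y, -, hxy⟩
      exact hxy.edge_mem
  · rintro ⟨x, y⟩ hxy ⟨x', y'⟩ hxy' hne
    simp only [Finset.mem_coe, Finset.mem_product, Finset.mem_compl, mem_vertexFinset] at hxy hxy'
    refine Finset.disjoint_left.2 fun e he he' => hne ?_
    replace he : G.IsLink e x y := (hfin x y).mem_toFinset.1 he
    replace he' : G.IsLink e x' y' := (hfin x' y').mem_toFinset.1 he'
    rcases he.eq_and_eq_or_eq_and_eq he' with ⟨h, h'⟩ | ⟨h, h'⟩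
    · rw [Subtype.ext h, Subtype.ext h']
    · exact absurd (h ▸ hxy.1) hxy'.2

/-- A nonempty set with fewer boundary edges than the minimum degree is large. -/
theorem max_le_card_vertexFinset [G.Loopless] (hE : E(G).Finite) {S : Set α}
    (hS : (G.vertexFinset S).Nonempty)
    (hcut : G.edgesBetween S (V(G) \ S) < G.minDegree) :
    max ⌈((G.minDegree : ℝ) + 1) / (G.multiplicity : ℝ)⌉₊ 2 ≤ (G.vertexFinset S).card := by
  classical
  set A := G.vertexFinset S with hA
  have h1 : A.card * G.minDegree ≤
      A.card * ((A.card - 1) * G.multiplicity) + G.edgesBetween S (V(G) \ S) := by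
    calc A.card * G.minDegree = ∑ x ∈ A, G.minDegree := by simp
      _ ≤ ∑ x ∈ A, ((A.card - 1) * G.multiplicity + ∑ y ∈ Aᶜ, G.edgeMult x y) := by
          refine Finset.sum_le_sum fun x hx => (G.minDegree_le_sum_edgeMult hE x).trans ?_
          rw [← Finset.sum_add_sum_compl A]
          refine Nat.add_le_add_right ?_ _
          rw [← Finset.sum_erase_add _ _ hx, edgeMult_self, add_zero, ← Finset.card_erase_of_mem hx,
            ← smul_eq_mul]
          refine Finset.sum_le_card_nsmul _ _ _ fun y hy => ?_
          refine G.edgeMult_le_multiplicity hE x.2 y.2 fun h => ?_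
          exact (Finset.mem_erase.1 hy).1 (Subtype.ext h.symm)
      _ ≤ _ := by
          rw [Finset.sum_add_distrib, Finset.sum_const, smul_eq_mul]
          exact Nat.add_le_add_left (G.sum_edgeMult_le_edgesBetween hE S) _
  obtain ⟨a, ha⟩ : ∃ a, A.card = a + 1 := ⟨A.card - 1, by have := hS.card_pos; omega⟩
  rw [ha, Nat.add_sub_cancel] at h1
  rw [ha]
  -- A single vertex has at least `δ` boundary edges, since there are no loops.
  have ha1 : 1 ≤ a := by
    by_contra! h
    obtain rfl : a = 0 := by omega
    omega
  -- With `|A| = a + 1` and fewer than `δ` boundary edges, `h1` gives `a δ < a (a + 1) m`; cancel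
  -- `a`.
  have h2 : G.minDegree + 1 ≤ (a + 1) * G.multiplicity := by
    by_contra! h
    have : a * ((a + 1) * G.multiplicity) ≤ a * G.minDegree := Nat.mul_le_mul_left a (by omega)
    nlinarith
  refine max_le (Nat.ceil_le.2 ?_) (by omega)
  have hm : 0 < G.multiplicity := Nat.pos_of_ne_zero fun h => by simp [h] at h2
  rw [div_le_iff₀ (by exact_mod_cast hm)]
  exact_mod_cast h2

end Graph

end

/-! ### Lower bounds for eigenvalues from disjoint sets -/

noncomputable section

open Matrix in
/-- A consequence of the min-max principle: a space of dimension more than `i` contains a nonzero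
vector whose Rayleigh quotient is at most the eigenvalue with index `i`. -/
theorem Matrix.IsHermitian.exists_dotProduct_mulVec_le {n W : Type*} [Fintype n] [DecidableEq n]
    [AddCommGroup W] [Module ℝ W] [FiniteDimensional ℝ W] {A : Matrix n n ℝ} (hA : A.IsHermitian)
    (i : Fin (Fintype.card n)) (L : W →ₗ[ℝ] (n → ℝ)) (hi : (i : ℕ) < Module.finrank ℝ W) :
    ∃ c ≠ 0, L c ⬝ᵥ A *ᵥ L c ≤ hA.eigenvalues₀ i * (L c ⬝ᵥ L c) := by
  set b := hA.eigenvectorBasis with hb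
  -- This is the enumeration relating `eigenvalues` to `eigenvalues₀`, so index order agrees with
  -- the size of the eigenvalues. The kernel of `M` imposes orthogonality to the first `i`
  -- eigenvectors: `i` conditions on a space of larger dimension.
  set e : Fin (Fintype.card n) ≃ n := Fintype.equivOfCardEq (Fintype.card_fin _) with he
  let M : W →ₗ[ℝ] (Fin i → ℝ) := LinearMap.pi fun a =>
    (dotProductBilin ℝ ℝ (b (e ⟨a, a.2.trans i.2⟩)).ofLp).comp L
  obtain ⟨c, hc, hc0⟩ := Submodule.exists_mem_ne_zero_of_ne_bot
    (LinearMap.ker_ne_bot_of_finrank_lt (f := M) (by simpa using hi))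
  refine ⟨c, hc0, ?_⟩
  set x := L c with hx
  have hcoef : ∀ j, (e.symm j : ℕ) < i → (b j).ofLp ⬝ᵥ x = 0 := by
    intro j hj
    have := congrFun (LinearMap.mem_ker.1 hc) ⟨e.symm j, hj⟩
    simpa [M] using this
  have hinner : ∀ y z : n → ℝ, inner ℝ (WithLp.toLp 2 y) (WithLp.toLp 2 z) = y ⬝ᵥ z := by
    intro y z
    rw [EuclideanSpace.inner_toLp_toLp, dotProduct_comm]
    simp
  have hexp : ∀ y z : n → ℝ, y ⬝ᵥ z = ∑ j, ((b j).ofLp ⬝ᵥ y) * ((b j).ofLp ⬝ᵥ z) := by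
    intro y z
    rw [← hinner, ← b.sum_inner_mul_inner]
    refine Finset.sum_congr rfl fun j _ => ?_
    rw [← hinner, ← hinner, real_inner_comm]
  have hAx : ∀ j, (b j).ofLp ⬝ᵥ A *ᵥ x = hA.eigenvalues j * ((b j).ofLp ⬝ᵥ x) := by
    intro j
    have h1 : (b j).ofLp ᵥ* A = hA.eigenvalues j • (b j).ofLp := by
      rw [← mulVec_transpose, ← hA.mulVec_eigenvectorBasis j]
      congr 1
    rw [dotProduct_mulVec, h1, smul_dotProduct, smul_eq_mul]
  rw [hexp x (A *ᵥ x), hexp x x, Finset.mul_sum]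
  refine Finset.sum_le_sum fun j _ => ?_
  rw [hAx]
  rcases lt_or_ge (e.symm j : ℕ) i with hj | hj
  · simp [hcoef j hj]
  · have h1 : hA.eigenvalues j ≤ hA.eigenvalues₀ i := hA.eigenvalues₀_antitone hj
    nlinarith [mul_le_mul_of_nonneg_right h1 (mul_self_nonneg ((b j).ofLp ⬝ᵥ x))]

namespace Graph

variable {α β : Type*} (G : Graph α β) [Fintype V(G)]

-- After symmetrizing in `u` and `v`, compare term by term: `x u * x v` equals `(x u ^ 2 + x v ^ 2)
-- / 2` when the values agree, and is at least its negative otherwise because `(x u + x v) ^ 2 ≥ 0`.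
open Matrix Classical in
theorem le_dotProduct_adjacencyMatrix_mulVec (x : V(G) → ℝ) :
    ∑ u, x u ^ 2 * ∑ v : V(G), (G.edgeMult u v : ℝ) -
        2 * ∑ u, x u ^ 2 * ∑ v : V(G), (if x v = x u then 0 else (G.edgeMult u v : ℝ)) ≤
      x ⬝ᵥ G.adjacencyMatrix *ᵥ x := by
  have hL : ∀ g : V(G) → V(G) → ℝ, (∀ u v, g u v = g v u) →
      ∑ u, x u ^ 2 * ∑ v, g u v = ∑ u, ∑ v, g u v * ((x u ^ 2 + x v ^ 2) / 2) := by
    intro g hg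
    have h1 : ∑ u, ∑ v, g u v * x u ^ 2 = ∑ u, x u ^ 2 * ∑ v, g u v :=
      Finset.sum_congr rfl fun u _ => by rw [Finset.mul_sum]; simp only [mul_comm]
    have h2 : ∑ u, ∑ v, g u v * x v ^ 2 = ∑ u, ∑ v, g u v * x u ^ 2 := by
      rw [Finset.sum_comm]
      exact Finset.sum_congr rfl fun u _ => Finset.sum_congr rfl fun v _ => by rw [hg]
    have h3 : ∑ u, ∑ v, g u v * ((x u ^ 2 + x v ^ 2) / 2) =
        (∑ u, ∑ v, g u v * x u ^ 2 + ∑ u, ∑ v, g u v * x v ^ 2) / 2 := by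
      simp only [← Finset.sum_add_distrib, Finset.sum_div]
      exact Finset.sum_congr rfl fun u _ => Finset.sum_congr rfl fun v _ => by ring
    rw [h3, h2, h1]
    ring
  rw [hL (fun u v => (G.edgeMult u v : ℝ)) (fun u v => by rw [G.edgeMult_comm]),
    hL (fun u v => if x v = x u then 0 else (G.edgeMult u v : ℝ))
      (fun u v => by simp only [G.edgeMult_comm u v, eq_comm]), Finset.mul_sum,
    ← Finset.sum_sub_distrib]
  simp only [dotProduct, mulVec, Finset.mul_sum, ← Finset.sum_sub_distrib]
  refine Finset.sum_le_sum fun u _ => Finset.sum_le_sum fun v _ => ?_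
  have h0 : (0 : ℝ) ≤ G.edgeMult u v := Nat.cast_nonneg _
  simp only [adjacencyMatrix, of_apply]
  split_ifs with h
  · rw [h]
    apply le_of_eq
    ring
  · nlinarith [mul_nonneg h0 (sq_nonneg (x u + x v))]

open Classical in
/-- If there are `q` disjoint vertex sets with at least `l` elements and at most `r` boundary edges,
the `q`-th largest eigenvalue is at least `δ - 2 r / l`. -/
theorem le_adjEigenvalue_of_disjoint (hE : E(G).Finite) {q : ℕ} (hq : 0 < q)
    (A : Fin q → Finset V(G)) (hA : ∀ i j, i ≠ j → Disjoint (A i) (A j)) {l : ℕ} (hl : 0 < l)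
    (hcard : ∀ i, l ≤ (A i).card) {r : ℕ}
    (hr : ∀ i, ∑ x ∈ A i, ∑ y ∈ (A i)ᶜ, G.edgeMult x y ≤ r) :
    (G.minDegree : ℝ) - 2 * r / l ≤ G.adjEigenvalue q := by
  have hqn : q ≤ Fintype.card V(G) := by
    have hne : ∀ i, (A i).Nonempty := fun i => Finset.card_pos.1 (hl.trans_le (hcard i))
    choose f hf using hne
    have hinj : Function.Injective f := fun i j hij => by
      by_contra h
      exact Finset.disjoint_left.1 (hA i j h) (hf i) (hij ▸ hf j)
    simpa using Fintype.card_le_of_injective f hinj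
  rw [adjEigenvalue, dif_pos ⟨hq, hqn⟩]
  -- Test vectors: the value `c i` on `A i`, and zero off the union.
  let L : (Fin q → ℝ) →ₗ[ℝ] (V(G) → ℝ) := LinearMap.pi fun u =>
    ∑ i, if u ∈ A i then LinearMap.proj i else 0
  obtain ⟨c, hc0, hc⟩ := G.adjacencyMatrix_isHermitian.exists_dotProduct_mulVec_le
    ⟨q - 1, by omega⟩ L (by simpa using hq)
  set lam := G.adjacencyMatrix_isHermitian.eigenvalues₀ ⟨q - 1, by omega⟩
  set x := L c with hx
  have hxA : ∀ i, ∀ u ∈ A i, x u = c i := by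
    intro i u hu
    simp only [hx, L, LinearMap.pi_apply, LinearMap.sum_apply]
    rw [Finset.sum_eq_single i]
    · simp [hu]
    · intro j _ hji
      rw [if_neg fun hj => Finset.disjoint_left.1 (hA j i hji) hj hu, LinearMap.zero_apply]
    · simp
  have hsum : ∀ g : V(G) → ℝ, ∑ u, x u ^ 2 * g u = ∑ i, c i ^ 2 * ∑ u ∈ A i, g u := by
    intro g
    have h0 : ∀ u, u ∉ Finset.univ.biUnion A → x u = 0 := by
      intro u hu
      simp only [Finset.mem_biUnion, Finset.mem_univ, true_and, not_exists] at hu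
      simp [hx, L, hu]
    rw [← Finset.sum_subset (Finset.subset_univ (Finset.univ.biUnion A))
      (fun u _ hu => by rw [h0 u hu]; ring), Finset.sum_biUnion fun i _ j _ hij => hA i j hij]
    refine Finset.sum_congr rfl fun i _ => ?_
    rw [Finset.mul_sum]
    exact Finset.sum_congr rfl fun u hu => by rw [hxA i u hu]
  have hxx : x ⬝ᵥ x = ∑ u, x u ^ 2 := Finset.sum_congr rfl fun u _ => (sq _).symm
  have hnorm : (l : ℝ) * ∑ i, c i ^ 2 ≤ x ⬝ᵥ x := by
    have := hsum fun _ => 1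
    simp only [mul_one, Finset.sum_const, nsmul_eq_mul] at this
    rw [hxx, this, Finset.mul_sum]
    refine Finset.sum_le_sum fun i _ => ?_
    rw [mul_comm]
    exact mul_le_mul_of_nonneg_left (by exact_mod_cast hcard i) (sq_nonneg _)
  have hcpos : 0 < ∑ i, c i ^ 2 := by
    obtain ⟨i, hi⟩ := Function.ne_iff.1 hc0
    exact Finset.sum_pos' (fun j _ => sq_nonneg _) ⟨i, Finset.mem_univ i, by
      have : c i ≠ 0 := hi
      positivity⟩
  have hl' : (0 : ℝ) < l := by exact_mod_cast hl
  have hxpos : 0 < x ⬝ᵥ x := lt_of_lt_of_le (by positivity) hnorm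
  have hdeg : (G.minDegree : ℝ) * (x ⬝ᵥ x) ≤
      ∑ u, x u ^ 2 * ∑ v : V(G), (G.edgeMult u v : ℝ) := by
    rw [hxx, Finset.mul_sum]
    refine Finset.sum_le_sum fun u _ => ?_
    rw [mul_comm]
    exact mul_le_mul_of_nonneg_left (by exact_mod_cast G.minDegree_le_sum_edgeMult hE u)
      (sq_nonneg _)
  -- A vertex whose value differs from that of `u ∈ A i` lies outside `A i`, so only boundary edges
  -- of `A i` contribute.
  have hbd : ∑ u, x u ^ 2 * ∑ v : V(G), (if x v = x u then 0 else (G.edgeMult u v : ℝ)) ≤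
      r * ∑ i, c i ^ 2 := by
    rw [hsum, Finset.mul_sum]
    refine Finset.sum_le_sum fun i _ => ?_
    rw [mul_comm]
    refine mul_le_mul_of_nonneg_right (le_trans ?_ (Nat.cast_le (α := ℝ).2 (hr i))) (sq_nonneg _)
    push_cast
    refine Finset.sum_le_sum fun u hu => ?_
    rw [← Finset.sum_add_sum_compl (A i), Finset.sum_eq_zero fun v hv => ?_, zero_add]
    · refine Finset.sum_le_sum fun v _ => ?_
      split_ifs
      · exact Nat.cast_nonneg _
      · exact le_rfl
    · rw [if_pos (by rw [hxA i u hu, hxA i v hv])]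
  have hmain := (G.le_dotProduct_adjacencyMatrix_mulVec x).trans hc
  have hr' : r * ∑ i, c i ^ 2 ≤ r / l * (x ⬝ᵥ x) := by
    calc (r : ℝ) * ∑ i, c i ^ 2 = r / l * (l * ∑ i, c i ^ 2) := by field_simp
      _ ≤ _ := mul_le_mul_of_nonneg_left hnorm (by positivity)
  refine le_of_mul_le_mul_right ?_ hxpos
  have : (2 * r / l : ℝ) = 2 * (r / l) := by ring
  rw [this]
  linarith

end Graph

end

/-! ### The theorem -/

theorem theorem6p3 {α β : Type*} (G : Graph α β) [Fintype V(G)] (hE : E(G).Finite)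
    [G.Loopless] (hG : G.HasTwoMinCuts) (k m l : ℕ) (hk : 2 ≤ k)
    (hm : m = G.multiplicity) (hδ : 2 * k ≤ G.minDegree)
    (hl : l = max ⌈((G.minDegree : ℝ) + 1) / (m : ℝ)⌉₊ 2)
    (hlam : G.adjEigenvalue 3 <
      2 * (G.minDegree : ℝ) - (G.maxDegree : ℝ) - 2 * (3 * (k : ℝ) - 1) / (l : ℝ)) :
    (k : ℕ∞) ≤ G.spanningTreePacking := by
  classical
  have hV : V(G).Nonempty := by
    obtain ⟨V₁, -, hV₁, -, hs₁, -⟩ := hG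
    exact hV₁.mono hs₁.subset
  refine G.le_spanningTreePacking_of_crossing hE hV k fun s => ?_
  by_contra! hs
  obtain ⟨A, hAV, hne, hdisj, hcut⟩ := hG.exists_three_cuts hE hs
  have hl0 : 0 < l := by rw [hl]; exact lt_max_of_lt_right two_pos
  have hcard : ∀ i, l ≤ (G.vertexFinset (A i)).card := by
    intro i
    obtain ⟨x, hx⟩ := hne i
    rw [hl, hm]
    exact G.max_le_card_vertexFinset hE ⟨⟨x, hAV i hx⟩, G.mem_vertexFinset.2 hx⟩
      ((hcut i).trans_le hδ)
  -- Boundaries below `2k` allow `r = 2k - 1`, which gives `λ₃ ≥ δ - 2(2k - 1)/l`.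
  have hlow := G.le_adjEigenvalue_of_disjoint hE three_pos (fun i => G.vertexFinset (A i))
    (fun i j hij => Finset.disjoint_left.2 fun x hx hx' =>
      Set.disjoint_left.1 (hdisj i j hij) (G.mem_vertexFinset.1 hx) (G.mem_vertexFinset.1 hx'))
    hl0 hcard (r := 2 * k - 1)
    (fun i => (G.sum_edgeMult_le_edgesBetween hE (A i)).trans (by have := hcut i; omega))
  have hΔ : (G.minDegree : ℝ) ≤ G.maxDegree := by
    exact_mod_cast G.minDegree_le_maxDegree hE hV
  have hr : ((2 * k - 1 : ℕ) : ℝ) ≤ 3 * k - 1 := by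
    rw [Nat.cast_sub (by omega)]
    push_cast
    linarith [Nat.cast_nonneg (α := ℝ) k]
  have : 2 * ((2 * k - 1 : ℕ) : ℝ) / l ≤ 2 * (3 * (k : ℝ) - 1) / l := by
    gcongr
  linarith
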